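/- Let $0<q<1$. For $x\in\mathbb{C}$ and an integer $n\ge 0$ put $(x;q)_n=\prod_{k=0}^{n-1}(1-xq^k)$ and $(x;q)_\infty=\prod_{k=0}^{\infty}(1-xq^k)$, and write $(x_1,\dots,x_m;q)_n=(x_1;q)_n\cdots(x_m;q)_n$ for $n\ge 0$ an integer or $n=\infty$. The basic hypergeometric series is $${}_r\phi_s\left({a_1,\dots,a_r \atop b_1,\dots,b_s};q,z\right)=\sum_{n=0}^\infty \frac{(a_1,\dots,a_r;q)_n}{(q,b_1,\dots,b_s;q)_n}\left((-1)^nq^{n(n-1)/2}\right)^{1+s-r}z^n .$$ **Theorem.** Let $\alpha,a,b,c\in\mathbb{C}$ with $\alpha\ne 1$, $a\neq 0$, $b\ne 0$ and $b\notin\{q,q^2,q^3,\dots\}$ (so that every term below is defined). If $\max\{|\alpha a|,|\alpha b|,|\alpha ac/q|\}<1$, then $$\frac{(q\alpha,\alpha c,\alpha ab/q;q)_\infty}{(\alpha a,\alpha b,\alpha ac/q;q)_\infty} =\sum_{n=0}^\infty\frac{(1-\alpha q^{2n})(\alpha,q/a,q/b;q)_n(-\alpha ab)^nq^{n(n-3)/2}}{(1-\alpha)(q,\alpha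 a,\alpha b;q)_n}\; {}_2\phi_1\left({q^{-n},\alpha q^n\atop q/b};q,\frac{qc}{b}\right),$$ where the series over $n$ converges absolutely. -/

import Mathlib

noncomputable section

/-- The finite `q`-shifted factorial `(a; q)_n = ∏_{k=0}^{n-1} (1 - a q^k)`. -/
def qShift (a q : ℂ) (n : ℕ) : ℂ :=
  ∏ k ∈ Finset.range n, (1 - a * q ^ k)

/-- The infinite `q`-shifted factorial `(a; q)_∞ = ∏_{k=0}^∞ (1 - a q^k)`. -/
def qShiftInf (a q : ℂ) : ℂ :=
  ∏' k : ℕ, (1 - a * q ^ k)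

/-- For `|q| < 1` the infinite product defining `(a; q)_∞` converges, so `qShiftInf` is its
actual value. -/
theorem hasProd_qShiftInf (a q : ℂ) (hq : ‖q‖ < 1) :
    HasProd (fun k : ℕ => 1 - a * q ^ k) (qShiftInf a q) := by
  have hs : Summable (fun k : ℕ => ‖-(a * q ^ k)‖) := by
    have := (summable_geometric_of_lt_one (norm_nonneg q) hq).mul_left ‖a‖
    simpa [norm_mul, norm_pow] using this
  have hm := multipliable_one_add_of_summable hs
  simpa [qShiftInf, sub_eq_add_neg] using hm.hasProd

/-- The compact notation `(a₁, …, a_m; q)_n = (a₁; q)_n ⋯ (a_m; q)_n`. -/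
def qShiftList (as : List ℂ) (q : ℂ) (n : ℕ) : ℂ :=
  (as.map fun a => qShift a q n).prod

/-- The compact notation `(a₁, …, a_m; q)_∞ = (a₁; q)_∞ ⋯ (a_m; q)_∞`. -/
def qShiftInfList (as : List ℂ) (q : ℂ) : ℂ :=
  (as.map fun a => qShiftInf a q).prod

/-- The basic hypergeometric series `_rφ_s(a₁, …, a_r; b₁, …, b_s; q, z)`:
the sum over `n ≥ 0` of
`(a₁, …, a_r; q)_n / (q, b₁, …, b_s; q)_n * ((-1)^n q^{n(n-1)/2})^{1+s-r} * z^n`. -/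
def basicHypergeometric (as bs : List ℂ) (q z : ℂ) : ℂ :=
  ∑' n : ℕ, qShiftList as q n / qShiftList (q :: bs) q n *
    ((-1) ^ n * q ^ (n * (n - 1) / 2)) ^ (1 + (bs.length : ℤ) - (as.length : ℤ)) * z ^ n

end

open Filter Topology

/-! Put `n = m + k` with `k` the index of the terminating `₂φ₁`, and expand into a double series
over `m, k ≥ 0`. It converges absolutely: `q ^ (m choose 2)` controls `m` and `|αac/q| < 1` controls
`k`, all other factors being bounded. For fixed `k` the sum over `m` is a limiting very-well-poised
`₆φ₅` with `(α, a, b)` replaced by `(αq^{2k}, a/q^k, b/q^k)`. Its product value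
(`hasSum_wellPoised`) leaves a constant times `(q/a;q)_k/(q;q)_k (αac/q)^k`, which
`hasSum_qBinomial` sums.

Both evaluations use one scheme: a first-order `q`-difference equation, iterated until the argument
tends to `0`, where dominated convergence gives the value `1`. -/

/-! ### Shifted factorials: splitting, limits and uniform bounds -/

lemma qShift_zero (x q : ℂ) : qShift x q 0 = 1 := by simp [qShift]

lemma qShift_succ (x q : ℂ) (n : ℕ) : qShift x q (n + 1) = qShift x q n * (1 - x * q ^ n) := by
  simp [qShift, Finset.prod_range_succ]

lemma qShift_add (x q : ℂ) (m n : ℕ) :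
    qShift x q (m + n) = qShift x q m * qShift (x * q ^ m) q n := by
  simp only [qShift, Finset.prod_range_add, pow_add, mul_assoc]

lemma qShift_succ' (x q : ℂ) (n : ℕ) : qShift x q (n + 1) = (1 - x) * qShift (x * q) q n := by
  rw [add_comm, qShift_add, qShift_succ, qShift_zero]
  simp

lemma qShift_ne_zero {x q : ℂ} (hx : ∀ k : ℕ, 1 - x * q ^ k ≠ 0) (n : ℕ) : qShift x q n ≠ 0 :=
  Finset.prod_ne_zero_iff.mpr fun k _ => hx k

lemma tendsto_qShift (x : ℂ) {q : ℂ} (hq : ‖q‖ < 1) :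
    Tendsto (fun n => qShift x q n) atTop (𝓝 (qShiftInf x q)) :=
  (hasProd_qShiftInf x q hq).tendsto_prod_nat

lemma qShift_mul_qShiftInf (x : ℂ) {q : ℂ} (hq : ‖q‖ < 1) (n : ℕ) :
    qShift x q n * qShiftInf (x * q ^ n) q = qShiftInf x q := by
  refine tendsto_nhds_unique ((tendsto_qShift (x * q ^ n) hq).const_mul (qShift x q n)) ?_
  simp only [← qShift_add]
  exact (tendsto_qShift x hq).comp (tendsto_add_atTop_nat n) |>.congr fun k => by
    simp [add_comm]

lemma qShiftInf_ne_zero {x q : ℂ} (hq : ‖q‖ < 1) (hx : ∀ k : ℕ, 1 - x * q ^ k ≠ 0) :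
    qShiftInf x q ≠ 0 := by
  have hs : Summable (fun k : ℕ => ‖-(x * q ^ k)‖) := by
    simpa [norm_mul, norm_pow] using
      (summable_geometric_of_lt_one (norm_nonneg q) hq).mul_left ‖x‖
  simpa [qShiftInf, sub_eq_add_neg] using
    tprod_one_add_ne_zero_of_summable (f := fun k : ℕ => -(x * q ^ k))
      (fun k => by simpa [sub_eq_add_neg] using hx k) hs

lemma one_sub_mul_pow_ne_zero {x q : ℂ} (hq : ‖q‖ < 1) (hx : ‖x‖ < 1) (k : ℕ) :
    1 - x * q ^ k ≠ 0 := by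
  intro h
  have h1 : ‖x * q ^ k‖ = 1 := by rw [← sub_eq_zero.mp h, norm_one]
  rw [norm_mul, norm_pow] at h1
  have : ‖q‖ ^ k ≤ 1 := pow_le_one₀ (norm_nonneg _) hq.le
  nlinarith [norm_nonneg x, pow_nonneg (norm_nonneg q) k]

lemma exists_norm_le_of_tendsto {u : ℕ → ℂ} {l : ℂ} (h : Tendsto u atTop (𝓝 l)) :
    ∃ C : ℝ, 0 ≤ C ∧ ∀ n, ‖u n‖ ≤ C := by
  obtain ⟨C, hC⟩ := h.norm.bddAbove_range
  have hC' : ∀ n, ‖u n‖ ≤ C := fun n => hC ⟨n, rfl⟩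
  exact ⟨C, (norm_nonneg _).trans (hC' 0), hC'⟩

lemma exists_norm_qShift_inv_le {x q : ℂ} (hq : ‖q‖ < 1) (hx : ∀ k : ℕ, 1 - x * q ^ k ≠ 0) :
    ∃ C : ℝ, 0 ≤ C ∧ ∀ n, ‖(qShift x q n)⁻¹‖ ≤ C :=
  exists_norm_le_of_tendsto ((tendsto_qShift x hq).inv₀ (qShiftInf_ne_zero hq hx))

lemma exists_norm_qShift_mul_pow_le (x : ℂ) {q : ℂ} (hq : ‖q‖ < 1) :
    ∃ C : ℝ, 0 ≤ C ∧ ∀ N n, ‖qShift (x * q ^ N) q n‖ ≤ C := by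
  -- The majorant `(-|x|;|q|)_n` dominates every shift `x q^N` at once, because `|q|^N ≤ 1`.
  obtain ⟨C, hC0, hC⟩ := exists_norm_le_of_tendsto
    (tendsto_qShift (-(‖x‖ : ℂ)) (q := (‖q‖ : ℂ)) (by simpa using hq))
  refine ⟨C, hC0, fun N n => le_trans ?_ (hC n)⟩
  simp only [qShift, norm_prod]
  refine Finset.prod_le_prod (fun _ _ => norm_nonneg _) fun k _ => ?_
  have h1 : (1 - -(‖x‖ : ℂ) * (‖q‖ : ℂ) ^ k) = ((1 + ‖x‖ * ‖q‖ ^ k : ℝ) : ℂ) := by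
    push_cast; ring
  rw [h1, Complex.norm_real, Real.norm_of_nonneg (by positivity)]
  refine (norm_sub_le _ _).trans ?_
  rw [norm_one, norm_mul, norm_mul, norm_pow, norm_pow]
  have : ‖q‖ ^ N ≤ 1 := pow_le_one₀ (norm_nonneg _) hq.le
  gcongr
  exact mul_le_of_le_one_right (norm_nonneg _) this

lemma exists_norm_qShift_le (x : ℂ) {q : ℂ} (hq : ‖q‖ < 1) :
    ∃ C : ℝ, 0 ≤ C ∧ ∀ n, ‖qShift x q n‖ ≤ C :=
  exists_norm_le_of_tendsto (tendsto_qShift x hq)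

lemma exists_norm_qShift_mul_pow_inv_le {x q : ℂ} (hq : ‖q‖ < 1)
    (hx : ∀ k : ℕ, 1 - x * q ^ k ≠ 0) :
    ∃ C : ℝ, 0 ≤ C ∧ ∀ N n, ‖(qShift (x * q ^ N) q n)⁻¹‖ ≤ C := by
  obtain ⟨C, hC0, hC⟩ := exists_norm_qShift_le x hq
  obtain ⟨D, hD0, hD⟩ := exists_norm_qShift_inv_le hq hx
  refine ⟨C * D, by positivity, fun N n => ?_⟩
  have h : (qShift (x * q ^ N) q n)⁻¹ = qShift x q N * (qShift x q (N + n))⁻¹ := by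
    rw [qShift_add, mul_inv, ← mul_assoc, mul_inv_cancel₀ (qShift_ne_zero hx N), one_mul]
  rw [h, norm_mul]
  exact mul_le_mul (hC N) (hD _) (norm_nonneg _) hC0

lemma choose_two_succ (m : ℕ) : (m + 1).choose 2 = m.choose 2 + m := by
  rw [Nat.choose_succ_succ' m 1, Nat.choose_one_right, add_comm]

/-- Consecutive terms have ratio `r s^m → 0`, so `r` may be arbitrarily large. -/
lemma summable_pow_mul_pow_choose_two (r : ℝ) {s : ℝ} (hs0 : 0 ≤ s) (hs : s < 1) :
    Summable fun m : ℕ => r ^ m * s ^ (m.choose 2) := by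
  have hl : Tendsto (fun m : ℕ => |r| * s ^ m) atTop (𝓝 0) := by
    simpa using (tendsto_pow_atTop_nhds_zero_of_lt_one hs0 hs).const_mul |r|
  refine summable_of_ratio_norm_eventually_le (r := 1 / 2) (by norm_num) ?_
  filter_upwards [hl.eventually (gt_mem_nhds (show (0 : ℝ) < 1 / 2 by norm_num))] with m hm
  have h : r ^ (m + 1) * s ^ ((m + 1).choose 2) = (r * s ^ m) * (r ^ m * s ^ (m.choose 2)) := by
    rw [choose_two_succ]; ring
  rw [h, norm_mul]
  gcongr
  rw [norm_mul, Real.norm_eq_abs, Real.norm_of_nonneg (by positivity)]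
  exact hm.le

/-! ### The `q`-binomial theorem -/

/-- The `q`-binomial theorem. -/
lemma hasSum_qBinomial {q : ℂ} (hq : ‖q‖ < 1) (A : ℂ) {z : ℂ} (hz : ‖z‖ < 1) :
    HasSum (fun k : ℕ => qShift A q k / qShift q q k * z ^ k)
      (qShiftInf (A * z) q / qShiftInf z q) := by
  have hqq := one_sub_mul_pow_ne_zero hq hq
  obtain ⟨C, hC0, hC⟩ := exists_norm_qShift_le A hq
  obtain ⟨D, hD0, hD⟩ := exists_norm_qShift_inv_le hq hqq
  set c : ℕ → ℂ := fun k => qShift A q k / qShift q q k with hc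
  have hcb : ∀ k, ‖c k‖ ≤ C * D := fun k => by
    rw [hc]; simp only [div_eq_mul_inv, norm_mul]
    exact mul_le_mul (hC k) (hD k) (norm_nonneg _) hC0
  have hcs : ∀ k, c (k + 1) * (1 - q ^ (k + 1)) = c k * (1 - A * q ^ k) := fun k => by
    have h1 := qShift_ne_zero hqq k
    have h2 := hqq k
    simp only [hc, qShift_succ]
    rw [← pow_succ'] at h2 ⊢
    field_simp
  have hbound : ∀ w : ℂ, ‖w‖ ≤ ‖z‖ → ∀ k, ‖c k * w ^ k‖ ≤ C * D * ‖z‖ ^ k := fun w hw k => by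
    rw [norm_mul, norm_pow]
    exact mul_le_mul (hcb k) (pow_le_pow_left₀ (norm_nonneg _) hw k) (by positivity)
      (by positivity)
  have hgs : Summable fun k : ℕ => C * D * ‖z‖ ^ k :=
    (summable_geometric_of_lt_one (norm_nonneg _) hz).mul_left _
  have hsum : ∀ w : ℂ, ‖w‖ ≤ ‖z‖ → Summable fun k => c k * w ^ k := fun w hw =>
    Summable.of_norm_bounded hgs (hbound w hw)
  have hzN : ∀ N : ℕ, ‖z * q ^ N‖ ≤ ‖z‖ := fun N => by
    rw [norm_mul, norm_pow]
    exact mul_le_of_le_one_right (norm_nonneg _) (pow_le_one₀ (norm_nonneg _) hq.le)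
  set f : ℂ → ℂ := fun w => ∑' k, c k * w ^ k with hf
  have hstep : ∀ w : ℂ, ‖w‖ ≤ ‖z‖ → ‖w * q‖ ≤ ‖z‖ → (1 - w) * f w = (1 - A * w) * f (w * q) := by
    intro w hw hwq
    have h1 := (hsum w hw).hasSum
    have h2 := (hsum _ hwq).hasSum
    have h3 : HasSum (fun k => c k * w ^ k - c k * (w * q) ^ k) (w * (f w - A * f (w * q))) := by
      have h4 : HasSum (fun k => c (k + 1) * w ^ (k + 1) - c (k + 1) * (w * q) ^ (k + 1))
          (w * (f w - A * f (w * q))) := by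
        refine ((h1.sub (h2.mul_left A)).mul_left w).congr_fun ?_
        intro k
        have := hcs k
        rw [mul_pow, mul_pow, pow_succ w]
        linear_combination (w ^ k * w) * this
      rw [← hasSum_nat_add_iff' 1]
      simpa using h4
    have h5 := (h1.sub h2).unique h3
    change f w - f (w * q) = _ at h5
    linear_combination h5
  have hiter : ∀ N, qShift z q N * f z = qShift (A * z) q N * f (z * q ^ N) := by
    intro N
    induction N with
    | zero => simp [qShift_zero]
    | succ N ih =>
      have h := hstep (z * q ^ N) (hzN N) (by simpa [pow_succ, mul_assoc] using hzN (N + 1))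
      rw [qShift_succ, qShift_succ, pow_succ, ← mul_assoc z]
      linear_combination (1 - z * q ^ N) * ih + qShift (A * z) q N * h
  have hlim : Tendsto (fun N : ℕ => f (z * q ^ N)) atTop (𝓝 1) := by
    have hz0 : Tendsto (fun N : ℕ => z * q ^ N) atTop (𝓝 0) := by
      simpa using (tendsto_pow_atTop_nhds_zero_of_norm_lt_one hq).const_mul z
    have h := tendsto_tsum_of_dominated_convergence (𝓕 := atTop)
      (f := fun (N : ℕ) k => c k * (z * q ^ N) ^ k) (g := fun k => c k * 0 ^ k) hgs
      (fun k => (hz0.pow k).const_mul (c k)) (Eventually.of_forall fun N => hbound _ (hzN N))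
    rw [tsum_eq_single 0 (fun k hk => by simp [hk])] at h
    simpa [hc, qShift_zero] using h
  have hfin := tendsto_nhds_unique ((tendsto_qShift z hq).mul_const (f z))
    (((tendsto_qShift (A * z) hq).mul hlim).congr fun N => (hiter N).symm)
  have hval : f z = qShiftInf (A * z) q / qShiftInf z q := by
    rw [eq_div_iff (qShiftInf_ne_zero hq (one_sub_mul_pow_ne_zero hq hz))]
    linear_combination hfin
  rw [← hval]
  exact (hsum z le_rfl).hasSum

/-! ### The limiting very-well-poised sum -/

/-- The summand of the limiting very-well-poised `₆φ₅` series without the factor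
`1 - α q ^ (2 m)`. -/
noncomputable def wellPoisedCoeff (q a b α : ℂ) (m : ℕ) : ℂ :=
  qShift α q m * qShift (q / a) q m * qShift (q / b) q m *
    ((qShift q q m)⁻¹ * (qShift (α * a) q m)⁻¹ * (qShift (α * b) q m)⁻¹) *
    ((-(α * a * b / q)) ^ m * q ^ m.choose 2)

lemma wellPoisedCoeff_succ {q a b α : ℂ} (hq0 : q ≠ 0) (hq : ‖q‖ < 1) (ha0 : a ≠ 0) (hb0 : b ≠ 0)
    (ha : ∀ k : ℕ, 1 - α * a * q ^ k ≠ 0) (hb : ∀ k : ℕ, 1 - α * b * q ^ k ≠ 0) (m : ℕ) :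
    (1 - α * a * q ^ m) * (1 - α * b * q ^ m) *
        (wellPoisedCoeff q a b α (m + 1) * (1 - q ^ (m + 1))) =
      -(wellPoisedCoeff q a b α m * (1 - α * q ^ m) * (a - q * q ^ m) * (b - q * q ^ m) *
        (α / q) * q ^ m) := by
  have hqq := one_sub_mul_pow_ne_zero hq hq
  have h1 := qShift_ne_zero hqq m
  have h2 := qShift_ne_zero ha m
  have h3 := qShift_ne_zero hb m
  have h4 : 1 - q ^ m * q ≠ 0 := by simpa only [mul_comm] using hqq m
  have h5 := ha m
  have h6 : 1 - α * q ^ m * b ≠ 0 := by simpa only [mul_right_comm] using hb m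
  simp only [wellPoisedCoeff, qShift_succ, choose_two_succ]
  rw [pow_succ (-(α * a * b / q)), pow_succ q m, pow_add, mul_comm q (q ^ m),
    mul_right_comm α b]
  field_simp

lemma wellPoisedCoeff_mul_q {q a b α : ℂ}
    (ha : ∀ k : ℕ, 1 - α * a * q ^ k ≠ 0) (hb : ∀ k : ℕ, 1 - α * b * q ^ k ≠ 0) (m : ℕ) :
    (1 - α * a * q ^ m) * (1 - α * b * q ^ m) * ((1 - α) * wellPoisedCoeff q a b (α * q) m) =
      (1 - α * a) * (1 - α * b) * (wellPoisedCoeff q a b α m * q ^ m * (1 - α * q ^ m)) := by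
  have key : ∀ x : ℂ, (1 - x) * qShift (x * q) q m = qShift x q m * (1 - x * q ^ m) := fun x => by
    rw [← qShift_succ', qShift_succ]
  have keyinv : ∀ x : ℂ, (∀ k : ℕ, 1 - x * q ^ k ≠ 0) →
      (1 - x * q ^ m) * (qShift (x * q) q m)⁻¹ = (1 - x) * (qShift x q m)⁻¹ := fun x hx => by
    have h1 := qShift_ne_zero hx m
    have h2 : qShift (x * q) q m ≠ 0 := by
      have := qShift_ne_zero hx (m + 1)
      rw [qShift_succ'] at this
      exact right_ne_zero_of_mul this
    have := key x
    field_simp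
    linear_combination -this
  have hA := keyinv _ ha
  have hB := keyinv _ hb
  have hα := key α
  simp only [wellPoisedCoeff]
  rw [show α * q * a = α * a * q by ring, show α * q * b = α * b * q by ring,
    show -(α * a * q * b / q) = -(α * a * b / q) * q by ring, mul_pow]
  calc _ = ((1 - α) * qShift (α * q) q m) *
        ((1 - α * a * q ^ m) * (qShift (α * a * q) q m)⁻¹) *
        ((1 - α * b * q ^ m) * (qShift (α * b * q) q m)⁻¹) *
        (qShift (q / a) q m * qShift (q / b) q m * (qShift q q m)⁻¹ *
          ((-(α * a * b / q)) ^ m * q ^ m * q ^ m.choose 2)) := by ring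
    _ = _ := by rw [hA, hB, hα]; ring

/-- This is the `q`-difference equation in `α`, termwise: the defect is a difference of consecutive
values of `h m = wellPoisedCoeff q a b α m * (1 - q ^ m)`. Since `h 0 = 0` and `h` tends to `0`,
summation over `m` removes it. -/
lemma wellPoised_telescope {q a b α : ℂ} (hq0 : q ≠ 0) (hq : ‖q‖ < 1) (ha0 : a ≠ 0) (hb0 : b ≠ 0)
    (ha : ∀ k : ℕ, 1 - α * a * q ^ k ≠ 0) (hb : ∀ k : ℕ, 1 - α * b * q ^ k ≠ 0) (m : ℕ) :
    (1 - α * a) * (1 - α * b) * ((1 - α * q ^ (2 * m)) * wellPoisedCoeff q a b α m) -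
        (1 - α) * (1 - α * a * b / q) *
          ((1 - α * q * q ^ (2 * m)) * wellPoisedCoeff q a b (α * q) m) =
      (1 - α * a) * (1 - α * b) * (wellPoisedCoeff q a b α m * (1 - q ^ m) -
        wellPoisedCoeff q a b α (m + 1) * (1 - q ^ (m + 1))) := by
  have h1 := wellPoisedCoeff_succ hq0 hq ha0 hb0 ha hb m
  have h2 := wellPoisedCoeff_mul_q ha hb m
  have hD : (1 - α * a * q ^ m) * (1 - α * b * q ^ m) ≠ 0 := mul_ne_zero (ha m) (hb m)
  apply mul_left_cancel₀ hD
  -- With `α = qβ` and `x = q^m` as free variables, no division remains and the claim is a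
  -- polynomial combination of the two recurrences.
  have h3 : q * (α / q) = α := by field_simp
  rw [pow_mul' q 2 m]
  rw [show α * a * b / q = a * b * (α / q) by ring]
  generalize q ^ m = x at *
  generalize wellPoisedCoeff q a b α m = h at *
  generalize wellPoisedCoeff q a b α (m + 1) * (1 - q ^ (m + 1)) = h' at *
  generalize α / q = β at *
  generalize wellPoisedCoeff q a b (α * q) m = k at *
  subst h3
  linear_combination (1 - q * β * a) * (1 - q * β * b) * h1 -
    (1 - a * b * β) * (1 - q * β * q * x ^ 2) * h2

/-- Uniformity in `N` supplies the majorant for the limit `αq^N → 0`. -/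
lemma exists_norm_wellPoisedCoeff_le {q a b α : ℂ} (hq : ‖q‖ < 1)
    (ha : ∀ k : ℕ, 1 - α * a * q ^ k ≠ 0) (hb : ∀ k : ℕ, 1 - α * b * q ^ k ≠ 0) :
    ∃ C : ℝ, 0 ≤ C ∧ ∀ N m, ‖wellPoisedCoeff q a b (α * q ^ N) m‖ ≤
      C * (‖α * a * b / q‖ ^ m * ‖q‖ ^ m.choose 2) := by
  obtain ⟨C1, h1, H1⟩ := exists_norm_qShift_mul_pow_le α hq
  obtain ⟨C2, h2, H2⟩ := exists_norm_qShift_le (q / a) hq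
  obtain ⟨C3, h3, H3⟩ := exists_norm_qShift_le (q / b) hq
  obtain ⟨C4, h4, H4⟩ := exists_norm_qShift_inv_le hq (one_sub_mul_pow_ne_zero hq hq)
  obtain ⟨C5, h5, H5⟩ := exists_norm_qShift_mul_pow_inv_le hq ha
  obtain ⟨C6, h6, H6⟩ := exists_norm_qShift_mul_pow_inv_le hq hb
  refine ⟨C1 * C2 * C3 * (C4 * C5 * C6), by positivity, fun N m => ?_⟩
  rw [wellPoisedCoeff, show α * q ^ N * a = α * a * q ^ N by ring,
    show α * q ^ N * b = α * b * q ^ N by ring]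
  simp only [norm_mul, norm_pow, norm_neg]
  have hN : ‖α * a * q ^ N * b / q‖ ≤ ‖α * a * b / q‖ := by
    rw [show α * a * q ^ N * b / q = α * a * b / q * q ^ N by ring, norm_mul, norm_pow]
    exact mul_le_of_le_one_right (norm_nonneg _) (pow_le_one₀ (norm_nonneg _) hq.le)
  have e1 := H1 N m
  have e2 := H2 m
  have e3 := H3 m
  have e4 := H4 m
  have e5 := H5 N m
  have e6 := H6 N m
  simp only [norm_inv] at e4 e5 e6 ⊢
  gcongr

/-- The nonterminating very-well-poised `₆φ₅` summation with one parameter sent to infinity. -/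
lemma hasSum_wellPoised {q a b α : ℂ} (hq0 : q ≠ 0) (hq : ‖q‖ < 1) (ha0 : a ≠ 0) (hb0 : b ≠ 0)
    (ha : ∀ k : ℕ, 1 - α * a * q ^ k ≠ 0) (hb : ∀ k : ℕ, 1 - α * b * q ^ k ≠ 0) :
    HasSum (fun m => (1 - α * q ^ (2 * m)) * wellPoisedCoeff q a b α m)
      (qShiftInf α q * qShiftInf (α * a * b / q) q /
        (qShiftInf (α * a) q * qShiftInf (α * b) q)) := by
  obtain ⟨C, hC0, hC⟩ := exists_norm_wellPoisedCoeff_le hq ha hb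
  set g : ℕ → ℝ := fun m => ‖α * a * b / q‖ ^ m * ‖q‖ ^ m.choose 2 with hg
  have hgs : Summable g := summable_pow_mul_pow_choose_two _ (norm_nonneg q) hq
  have hpow : ∀ n : ℕ, ‖q ^ n‖ ≤ 1 := fun n => by
    rw [norm_pow]; exact pow_le_one₀ (norm_nonneg _) hq.le
  set t : ℂ → ℕ → ℂ := fun x m => (1 - x * q ^ (2 * m)) * wellPoisedCoeff q a b x m with ht
  have hbound : ∀ N m, ‖t (α * q ^ N) m‖ ≤ (1 + ‖α‖) * (C * g m) := fun N m => by
    rw [ht, norm_mul]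
    refine mul_le_mul ?_ (hC N m) (norm_nonneg _) (by positivity)
    refine (norm_sub_le _ _).trans ?_
    rw [norm_one, norm_mul, norm_mul]
    gcongr
    calc ‖α‖ * ‖q ^ N‖ * ‖q ^ (2 * m)‖ ≤ ‖α‖ * 1 * 1 := by gcongr <;> exact hpow _
      _ = ‖α‖ := by ring
  have hgs' : Summable fun m => (1 + ‖α‖) * (C * g m) := (hgs.mul_left C).mul_left _
  have hsum : ∀ N, Summable (t (α * q ^ N)) := fun N => Summable.of_norm_bounded hgs' (hbound N)
  set S : ℕ → ℂ := fun N => ∑' m, t (α * q ^ N) m with hS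
  have hstep : ∀ N, (1 - α * a * q ^ N) * (1 - α * b * q ^ N) * S N =
      (1 - α * q ^ N) * (1 - α * a * b / q * q ^ N) * S (N + 1) := by
    intro N
    have ha' : ∀ k : ℕ, 1 - α * q ^ N * a * q ^ k ≠ 0 := fun k => by
      convert ha (N + k) using 2; ring
    have hb' : ∀ k : ℕ, 1 - α * q ^ N * b * q ^ k ≠ 0 := fun k => by
      convert hb (N + k) using 2; ring
    set h : ℕ → ℂ := fun m => wellPoisedCoeff q a b (α * q ^ N) m * (1 - q ^ m) with hh
    have hhs : Summable h := by
      refine Summable.of_norm_bounded ((hgs.mul_left C).mul_right 2) fun m => ?_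
      rw [hh, norm_mul]
      refine mul_le_mul (hC N m) ?_ (norm_nonneg _) (by positivity)
      refine (norm_sub_le _ _).trans ?_
      rw [norm_one]
      linarith [hpow m]
    have h0 : ∑' m, (h m - h (m + 1)) = 0 := by
      rw [hhs.tsum_sub ((summable_nat_add_iff 1).mpr hhs), hhs.tsum_eq_zero_add]
      simp [hh]
    have hN1 : α * q ^ N * q = α * q ^ (N + 1) := by ring
    have htel := congrArg tsum (funext fun m =>
      wellPoised_telescope hq0 hq ha0 hb0 ha' hb' m)
    rw [tsum_mul_left, h0, mul_zero, hN1,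
      Summable.tsum_sub ((hsum N).mul_left _) ((hsum (N + 1)).mul_left _),
      tsum_mul_left, tsum_mul_left] at htel
    change _ * S N - _ * S (N + 1) = 0 at htel
    linear_combination htel
  have hiter : ∀ N, qShift (α * a) q N * qShift (α * b) q N * S 0 =
      qShift α q N * qShift (α * a * b / q) q N * S N := by
    intro N
    induction N with
    | zero => simp [qShift_zero]
    | succ N ih =>
      simp only [qShift_succ]
      linear_combination (1 - α * a * q ^ N) * (1 - α * b * q ^ N) * ih +
        qShift α q N * qShift (α * a * b / q) q N * hstep N
  -- At `x = 0` the denominators `(xa;q)_m` and `(xb;q)_m` equal `1`.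
  have hcont : ∀ m, ContinuousAt (fun x => t x m) 0 := by
    intro m
    have hc : ∀ y : ℂ, ContinuousAt (fun x : ℂ => qShift (x * y) q m) 0 := fun y => by
      unfold qShift; fun_prop
    have hi : ∀ y : ℂ, ContinuousAt (fun x : ℂ => (qShift (x * y) q m)⁻¹) 0 := fun y =>
      (hc y).inv₀ (by simp [qShift])
    have h1 : ContinuousAt (fun x : ℂ => qShift x q m) 0 := by simpa using hc 1
    have h2 : ContinuousAt (fun x : ℂ => (-(x * a * b / q)) ^ m) 0 := by fun_prop
    have h3 : ContinuousAt (fun x : ℂ => 1 - x * q ^ (2 * m)) 0 := by fun_prop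
    exact h3.mul ((((h1.mul continuousAt_const).mul continuousAt_const).mul
      ((continuousAt_const.mul (hi a)).mul (hi b))).mul (h2.mul continuousAt_const))
  have ht0 : ∀ m, m ≠ 0 → t 0 m = 0 := fun m hm => by simp [ht, wellPoisedCoeff, hm]
  have hlim : Tendsto S atTop (𝓝 1) := by
    have hz0 : Tendsto (fun N : ℕ => α * q ^ N) atTop (𝓝 0) := by
      simpa using (tendsto_pow_atTop_nhds_zero_of_norm_lt_one hq).const_mul α
    have h := tendsto_tsum_of_dominated_convergence (𝓕 := atTop)
      (f := fun (N : ℕ) m => t (α * q ^ N) m) (g := fun m => t 0 m) hgs'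
      (fun m => (hcont m).tendsto.comp hz0) (Eventually.of_forall hbound)
    have h1 : t 0 0 = 1 := by simp [ht, wellPoisedCoeff, qShift_zero]
    rw [tsum_eq_single 0 ht0, h1] at h
    exact h
  have hfin := tendsto_nhds_unique
    (((tendsto_qShift (α * a) hq).mul (tendsto_qShift (α * b) hq)).mul_const (S 0))
    ((((tendsto_qShift α hq).mul (tendsto_qShift (α * a * b / q) hq)).mul hlim).congr
      fun N => (hiter N).symm)
  have hval : S 0 = qShiftInf α q * qShiftInf (α * a * b / q) q /
      (qShiftInf (α * a) q * qShiftInf (α * b) q) := by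
    rw [eq_div_iff (mul_ne_zero (qShiftInf_ne_zero hq ha) (qShiftInf_ne_zero hq hb))]
    linear_combination hfin
  rw [← hval]
  simpa [hS] using (hsum 0).hasSum

/-! ### The double series -/

/-- The summand of the double series obtained by expanding the terminating `₂φ₁` series, indexed
by `m = n - k` and the summation index `k` of the `₂φ₁` series. -/
noncomputable def doubleTerm (q a b c α : ℂ) (m k : ℕ) : ℂ :=
  (1 - α * q ^ (2 * (m + k))) * (1 - α)⁻¹ *
    (qShift α q (m + 2 * k) * qShift (q / a) q (m + k) * qShift (q / b) q (m + k)) *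
    ((qShift (α * a) q (m + k))⁻¹ * (qShift (α * b) q (m + k))⁻¹) *
    ((qShift q q m)⁻¹ * (qShift q q k)⁻¹ * (qShift (q / b) q k)⁻¹) *
    ((-(α * a * b / q)) ^ m * q ^ m.choose 2 * (α * a * c / q) ^ k)

lemma doubleTerm_eq {q a b c α : ℂ} (hq0 : q ≠ 0) (m k : ℕ) :
    doubleTerm q a b c α m k =
      (1 - α)⁻¹ * (qShift α q (2 * k) * qShift (q / a) q k * qShift (q / b) q k *
        ((qShift (α * a) q k)⁻¹ * (qShift (α * b) q k)⁻¹) *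
        ((qShift q q k)⁻¹ * (qShift (q / b) q k)⁻¹) * (α * a * c / q) ^ k) *
      ((1 - α * q ^ (2 * k) * q ^ (2 * m)) *
        wellPoisedCoeff q (a / q ^ k) (b / q ^ k) (α * q ^ (2 * k)) m) := by
  have hk : q ^ k ≠ 0 := pow_ne_zero k hq0
  have e1 : q / (a / q ^ k) = q / a * q ^ k := by rw [div_div_eq_mul_div]; ring
  have e2 : q / (b / q ^ k) = q / b * q ^ k := by rw [div_div_eq_mul_div]; ring
  have e3 : ∀ x : ℂ, α * q ^ (2 * k) * (x / q ^ k) = α * x * q ^ k := fun x => by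
    rw [pow_mul' q 2 k]; field_simp
  have e4 : α * a * q ^ k * (b / q ^ k) / q = α * a * b / q := by field_simp
  simp only [doubleTerm, wellPoisedCoeff, e1, e2, e3, e4]
  rw [add_comm m k, add_comm m (2 * k)]
  simp only [qShift_add, mul_inv, mul_add, pow_add]
  ring

/-- The substitution fixes `αab/q` and turns `αa, αb` into `αaq^k, αbq^k`. The finite factors
`(α;q)_{2k}`, `(αa;q)_k`, `(αb;q)_k` therefore complete the infinite products to ones free of `k`,
while `(q/b;q)_k` cancels. -/
lemma hasSum_doubleTerm_left {q a b c α : ℂ} (hq0 : q ≠ 0) (hq : ‖q‖ < 1) (ha0 : a ≠ 0)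
    (hb0 : b ≠ 0) (hα : α ≠ 1)
    (ha : ∀ k : ℕ, 1 - α * a * q ^ k ≠ 0) (hb : ∀ k : ℕ, 1 - α * b * q ^ k ≠ 0)
    (hqb : ∀ k : ℕ, 1 - q / b * q ^ k ≠ 0) (k : ℕ) :
    HasSum (fun m => doubleTerm q a b c α m k)
      (qShiftInf (q * α) q * qShiftInf (α * a * b / q) q /
          (qShiftInf (α * a) q * qShiftInf (α * b) q) *
        (qShift (q / a) q k / qShift q q k * (α * a * c / q) ^ k)) := by
  have hk : q ^ k ≠ 0 := pow_ne_zero k hq0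
  have e3 : ∀ x : ℂ, α * q ^ (2 * k) * (x / q ^ k) = α * x * q ^ k := fun x => by
    rw [pow_mul' q 2 k]; field_simp
  have e4 : α * a * q ^ k * (b / q ^ k) / q = α * a * b / q := by field_simp
  have h := hasSum_wellPoised (q := q) (a := a / q ^ k) (b := b / q ^ k) (α := α * q ^ (2 * k))
    hq0 hq (div_ne_zero ha0 hk) (div_ne_zero hb0 hk)
    (fun j => by rw [e3, mul_assoc, ← pow_add]; exact ha _)
    (fun j => by rw [e3, mul_assoc, ← pow_add]; exact hb _)
  simp only [e3, e4] at h
  simp only [doubleTerm_eq hq0]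
  convert h.mul_left ((1 - α)⁻¹ * (qShift α q (2 * k) * qShift (q / a) q k * qShift (q / b) q k *
    ((qShift (α * a) q k)⁻¹ * (qShift (α * b) q k)⁻¹) *
    ((qShift q q k)⁻¹ * (qShift (q / b) q k)⁻¹) * (α * a * c / q) ^ k)) using 1
  · rfl
  have hα1 : 1 - α ≠ 0 := sub_ne_zero.mpr hα.symm
  have hαinf : qShiftInf (q * α) q = (1 - α)⁻¹ * (qShift α q (2 * k) *
      qShiftInf (α * q ^ (2 * k)) q) := by
    rw [qShift_mul_qShiftInf α hq, ← qShift_mul_qShiftInf α hq 1, qShift_succ, qShift_zero, pow_zero,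
      pow_one, mul_comm α q]
    field_simp
  have h3 := qShift_ne_zero hqb k
  rw [hαinf, ← qShift_mul_qShiftInf (α * a) hq k, ← qShift_mul_qShiftInf (α * b) hq k]
  simp only [div_eq_mul_inv, mul_inv]
  have h4 := mul_inv_cancel₀ h3
  simp only [div_eq_mul_inv] at h4
  linear_combination (-(qShiftInf (α * a * b * q⁻¹) q * (1 - α)⁻¹ * (qShift α q (2 * k) *
      qShiftInf (α * q ^ (2 * k)) q) * (qShift (α * a) q k)⁻¹ *
      (qShiftInf (α * a * q ^ k) q)⁻¹ * (qShift (α * b) q k)⁻¹ *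
      (qShiftInf (α * b * q ^ k) q)⁻¹ * qShift (q * a⁻¹) q k * (qShift q q k)⁻¹ *
      (α * a * c * q⁻¹) ^ k)) * h4

lemma summable_doubleTerm {q a b c α : ℂ} (hq : ‖q‖ < 1)
    (ha : ∀ k : ℕ, 1 - α * a * q ^ k ≠ 0) (hb : ∀ k : ℕ, 1 - α * b * q ^ k ≠ 0)
    (hqb : ∀ k : ℕ, 1 - q / b * q ^ k ≠ 0) (hc : ‖α * a * c / q‖ < 1) :
    Summable fun p : ℕ × ℕ => doubleTerm q a b c α p.1 p.2 := by
  obtain ⟨C1, h1, H1⟩ := exists_norm_qShift_le α hq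
  obtain ⟨C2, h2, H2⟩ := exists_norm_qShift_le (q / a) hq
  obtain ⟨C3, h3, H3⟩ := exists_norm_qShift_le (q / b) hq
  obtain ⟨C4, h4, H4⟩ := exists_norm_qShift_inv_le hq (one_sub_mul_pow_ne_zero hq hq)
  obtain ⟨C5, h5, H5⟩ := exists_norm_qShift_inv_le hq ha
  obtain ⟨C6, h6, H6⟩ := exists_norm_qShift_inv_le hq hb
  obtain ⟨C7, h7, H7⟩ := exists_norm_qShift_inv_le hq hqb
  have hs := (summable_pow_mul_pow_choose_two ‖α * a * b / q‖ (norm_nonneg q) hq).mul_of_nonneg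
    (summable_geometric_of_lt_one (norm_nonneg _) hc)
    (fun _ => by positivity) (fun _ => by positivity)
  refine Summable.of_norm_bounded (hs.mul_left ((1 + ‖α‖) * ‖(1 - α)⁻¹‖ * (C1 * C2 * C3) *
    (C5 * C6) * (C4 * C4 * C7))) ?_
  rintro ⟨m, k⟩
  have e0 : ‖1 - α * q ^ (2 * (m + k))‖ ≤ 1 + ‖α‖ := by
    refine (norm_sub_le _ _).trans ?_
    rw [norm_one, norm_mul, norm_pow]
    gcongr
    exact mul_le_of_le_one_right (norm_nonneg _) (pow_le_one₀ (norm_nonneg _) hq.le)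
  have e1 := H1 (m + 2 * k)
  have e2 := H2 (m + k)
  have e3 := H3 (m + k)
  have e4 := H4 m
  have e4' := H4 k
  have e5 := H5 (m + k)
  have e6 := H6 (m + k)
  have e7 := H7 k
  simp only [doubleTerm, norm_mul, norm_pow, norm_neg]
  gcongr

/-! ### Matching the original summand with the double series -/

/-- Each factor is `1 - q^{-j} = -q^{-j}(1 - q^j)` for `m < j ≤ m + k`; the exponents `j` add up to
the difference of the two binomial coefficients. -/
lemma qShift_zpow_neg {q : ℂ} (hq0 : q ≠ 0) (m k : ℕ) :
    qShift (q ^ (-((m + k : ℕ) : ℤ))) q k * qShift q q m * q ^ ((m + k + 1).choose 2) =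
      (-1) ^ k * q ^ ((m + 1).choose 2) * qShift q q (m + k) := by
  induction k with
  | zero => simp [qShift_zero]; ring
  | succ k ih =>
    have h1 : q ^ (-((m + (k + 1) : ℕ) : ℤ)) * q = q ^ (-((m + k : ℕ) : ℤ)) := by
      rw [← zpow_add_one₀ hq0]; congr 1; push_cast; ring
    have h2 : q ^ (-((m + (k + 1) : ℕ) : ℤ)) * q ^ (m + k + 1) = 1 := by
      rw [← zpow_natCast, ← zpow_add₀ hq0, ← zpow_zero q]; congr 1; push_cast; ring
    rw [qShift_succ', h1, choose_two_succ (m + (k + 1)), ← add_assoc m k 1, qShift_succ, pow_add,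
      pow_succ (-1 : ℂ)]
    rw [← add_assoc m k 1] at h2
    generalize q ^ (-((m + k + 1 : ℕ) : ℤ)) = y at *
    linear_combination (1 - y) * q ^ (m + k + 1) * ih -
      (-1) ^ k * q ^ ((m + 1).choose 2) * qShift q q (m + k) * h2 +
      (-1) ^ k * q ^ ((m + 1).choose 2) * qShift q q (m + k) * (pow_succ' q (m + k))

lemma qShift_zpow_neg_of_lt {q : ℂ} (hq0 : q ≠ 0) {n k : ℕ} (h : n < k) :
    qShift (q ^ (-(n : ℤ))) q k = 0 := by
  refine Finset.prod_eq_zero (Finset.mem_range.mpr h) ?_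
  rw [zpow_neg, zpow_natCast, inv_mul_cancel₀ (pow_ne_zero n hq0), sub_self]

lemma basicHypergeometric_two_one_terminating {q : ℂ} (hq0 : q ≠ 0) (x y z : ℂ) (n : ℕ) :
    basicHypergeometric [q ^ (-(n : ℤ)), x] [y] q z =
      ∑ k ∈ Finset.range (n + 1), qShift (q ^ (-(n : ℤ))) q k * qShift x q k /
        (qShift q q k * qShift y q k) * z ^ k := by
  rw [basicHypergeometric, tsum_eq_sum (s := Finset.range (n + 1))]
  · refine Finset.sum_congr rfl fun k _ => ?_
    -- Here `1 + s - r = 0`, so the sign and power factor is trivial.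
    simp [qShiftList]
  · intro k hk
    rw [Finset.mem_range, not_lt] at hk
    have h := qShift_zpow_neg_of_lt hq0 (show n < k from hk)
    simp only [qShiftList, List.map_cons, List.prod_cons, h, zero_mul, zero_div]

/-- The exponent `n(n-3)/2` is `-1` at `n = 1, 2`, hence the integer power; the integer division is
exact. -/
lemma zpow_mul_sub_three_div_two {q : ℂ} (hq0 : q ≠ 0) (n : ℕ) :
    q ^ ((n : ℤ) * ((n : ℤ) - 3) / 2) * q ^ (2 * n) = q ^ ((n + 1).choose 2) := by
  have h : (n : ℤ) * ((n : ℤ) - 3) / 2 = (((n + 1).choose 2 : ℕ) : ℤ) - ((2 * n : ℕ) : ℤ) := by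
    have h1 : (((n + 1).choose 2 : ℕ) : ℤ) * 2 = (n + 1) * n := by
      have := Nat.add_one_mul_choose_eq n 1
      rw [Nat.choose_one_right] at this
      exact_mod_cast this.symm
    rw [show (n : ℤ) * ((n : ℤ) - 3) = ((((n + 1).choose 2 : ℕ) : ℤ) - ((2 * n : ℕ) : ℤ)) * 2 by
      push_cast at h1 ⊢; linear_combination -h1]
    exact Int.mul_ediv_cancel _ two_ne_zero
  rw [h, ← zpow_natCast q (2 * n), ← zpow_add₀ hq0, sub_add_cancel, zpow_natCast]

lemma summand_eq_doubleTerm {q a b c α : ℂ} (hq0 : q ≠ 0) (hq : ‖q‖ < 1) (hb0 : b ≠ 0)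
    (m k : ℕ) :
    (1 - α * q ^ (2 * (m + k))) * qShiftList [α, q / a, q / b] q (m + k) *
          (-(α * a * b)) ^ (m + k) *
          q ^ (((m + k : ℕ) : ℤ) * (((m + k : ℕ) : ℤ) - 3) / 2) /
        ((1 - α) * qShiftList [q, α * a, α * b] q (m + k)) *
        (qShift (q ^ (-((m + k : ℕ) : ℤ))) q k * qShift (α * q ^ (m + k)) q k /
          (qShift q q k * qShift (q / b) q k) * (q * c / b) ^ k) =
      doubleTerm q a b c α m k := by
  have hqq := one_sub_mul_pow_ne_zero hq hq
  have h1 := qShift_ne_zero hqq m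
  have h2 := qShift_ne_zero hqq (m + k)
  have hX : q ^ ((m + k + 1).choose 2) ≠ 0 := pow_ne_zero _ hq0
  have hA : qShift (q ^ (-((m + k : ℕ) : ℤ))) q k * (qShift q q (m + k))⁻¹ *
      q ^ ((m + k + 1).choose 2) = (-1) ^ k * q ^ (m.choose 2 + m) * (qShift q q m)⁻¹ := by
    have := qShift_zpow_neg hq0 m k
    rw [choose_two_succ m] at this
    field_simp
    linear_combination this
  have hB : qShift α q (m + 2 * k) = qShift α q (m + k) * qShift (α * q ^ (m + k)) q k := by
    rw [← qShift_add]; congr 1; ring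
  have hZ : q ^ (((m + k : ℕ) : ℤ) * (((m + k : ℕ) : ℤ) - 3) / 2) =
      q ^ ((m + k + 1).choose 2) * (q ^ (2 * (m + k)))⁻¹ := by
    rw [← zpow_mul_sub_three_div_two hq0 (m + k),
      mul_inv_cancel_right₀ (pow_ne_zero _ hq0)]
  have hP : (-(α * a * b)) ^ (m + k) * (q ^ (2 * (m + k)))⁻¹ * (q * c / b) ^ k *
      ((-1) ^ k * q ^ (m.choose 2 + m)) =
      (-(α * a * b / q)) ^ m * q ^ m.choose 2 * (α * a * c / q) ^ k := by
    have hm : -(α * a * b) * (q ^ 2)⁻¹ * q = -(α * a * b / q) := by field_simp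
    have hk : -(α * a * b) * (q ^ 2)⁻¹ * (q * c / b) * (-1) = α * a * c / q := by field_simp
    rw [← hm, ← hk]
    simp only [mul_pow, pow_add, pow_mul, inv_pow, mul_inv]
    ring
  rw [doubleTerm, hB, hZ, ← hP]
  simp only [qShiftList, List.map_cons, List.map_nil, List.prod_cons, List.prod_nil, mul_one,
    div_eq_mul_inv, mul_inv] at hA ⊢
  linear_combination ((1 - α * q ^ (2 * (m + k))) * (1 - α)⁻¹ * (qShift α q (m + k) *
    qShift (α * q ^ (m + k)) q k * qShift (q * a⁻¹) q (m + k) * qShift (q * b⁻¹) q (m + k)) *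
    ((qShift (α * a) q (m + k))⁻¹ * (qShift (α * b) q (m + k))⁻¹) *
    ((qShift q q k)⁻¹ * (qShift (q * b⁻¹) q k)⁻¹) *
    ((-(α * a * b)) ^ (m + k) * (q ^ (2 * (m + k)))⁻¹ * (q * c * b⁻¹) ^ k)) * hA

theorem mainTheorem5 (q : ℝ) (hq0 : 0 < q) (hq1 : q < 1) (α a b c : ℂ)
    (hα : α ≠ 1) (ha : a ≠ 0) (hb : b ≠ 0)
    (hbq : ∀ j : ℕ, b ≠ (q : ℂ) ^ (j + 1))
    (hmax : max (max ‖α * a‖ ‖α * b‖) ‖α * a * c / (q : ℂ)‖ < 1) :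
    HasSum
      (fun n : ℕ =>
        (1 - α * (q : ℂ) ^ (2 * n)) * qShiftList [α, (q : ℂ) / a, (q : ℂ) / b] (q : ℂ) n *
            (-(α * a * b)) ^ n * (q : ℂ) ^ ((n : ℤ) * ((n : ℤ) - 3) / 2) /
          ((1 - α) * qShiftList [(q : ℂ), α * a, α * b] (q : ℂ) n) *
          basicHypergeometric [(q : ℂ) ^ (-(n : ℤ)), α * (q : ℂ) ^ n] [(q : ℂ) / b] (q : ℂ)
            ((q : ℂ) * c / b))
      (qShiftInfList [(q : ℂ) * α, α * c, α * a * b / (q : ℂ)] (q : ℂ) /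
        qShiftInfList [α * a, α * b, α * a * c / (q : ℂ)] (q : ℂ)) := by
  obtain ⟨hab, hc⟩ := max_lt_iff.mp hmax
  obtain ⟨hαa, hαb⟩ := max_lt_iff.mp hab
  have hQ0 : (q : ℂ) ≠ 0 := by exact_mod_cast hq0.ne'
  have hQ : ‖(q : ℂ)‖ < 1 := by rwa [Complex.norm_real, Real.norm_of_nonneg hq0.le]
  have hqb : ∀ k : ℕ, 1 - (q : ℂ) / b * (q : ℂ) ^ k ≠ 0 := fun k h => by
    refine hbq k ?_
    field_simp at h
    linear_combination h
  generalize (q : ℂ) = Q at *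
  have hA := one_sub_mul_pow_ne_zero hQ hαa
  have hB := one_sub_mul_pow_ne_zero hQ hαb
  have hT := (summable_doubleTerm hQ hA hB hqb hc).hasSum
  -- Summing over `m` first determines the total; regrouping the same family along `m + k = n` then
  -- gives the stated series.
  have hrow := ((Equiv.prodComm ℕ ℕ).hasSum_iff.mpr hT).prod_fiberwise
    (hasSum_doubleTerm_left hQ0 hQ ha hb hα hA hB hqb)
  have hval := hrow.unique ((hasSum_qBinomial hQ (Q / a) hc).mul_left _)
  rw [hval] at hT
  have hdiag := (Finset.HasAntidiagonal.sigmaAntidiagonalEquivProd.hasSum_iff.mpr hT).sigma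
    (fun n => hasSum_fintype _)
  convert hdiag using 1
  · funext n
    rw [basicHypergeometric_two_one_terminating hQ0, Finset.mul_sum]
    simp only [Function.comp_apply, Finset.HasAntidiagonal.sigmaAntidiagonalEquivProd_apply]
    rw [Finset.sum_coe_sort (Finset.HasAntidiagonal.antidiagonal n) (fun p : ℕ × ℕ => doubleTerm Q a b c α p.1 p.2),
      ← Finset.Nat.sum_antidiagonal_swap]
    simp only [Prod.fst_swap, Prod.snd_swap]
    rw [Finset.Nat.sum_antidiagonal_eq_sum_range_succ (fun i j => doubleTerm Q a b c α j i)]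
    refine Finset.sum_congr rfl fun k hk => ?_
    obtain ⟨m, rfl⟩ := Nat.exists_eq_add_of_le' (Finset.mem_range_succ_iff.mp hk)
    rw [Nat.add_sub_cancel, ← summand_eq_doubleTerm hQ0 hQ hb]
  · have h : Q / a * (α * a * c / Q) = α * c := by field_simp
    simp only [qShiftInfList, List.map_cons, List.map_nil, List.prod_cons, List.prod_nil, mul_one, h]
    simp only [div_eq_mul_inv, mul_inv]
    ring
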